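/- Let $n \ge 2$ and $k \ge 3$, and let $C_1,\dots,C_n$ be simple closed curves in the plane, any two of which meet in finitely many points, such that all $2^n$ sets $X_1\cap\dots\cap X_n$, where each $X_i$ is either the bounded interior or the unbounded exterior of $C_i$, are non-empty and connected (an $n$-Venn diagram, not necessarily simple). Suppose that each $C_i$ is (the boundary of) a convex polygon with exactly $k$ sides. Let $V$ be the number of vertices of the diagram, that is, the number of points of the plane that lie on at least two of the curves. Then $V$ is finite and $$V \le 2k\binom{n}{2} - n(k-1).$$ -/

import Mathlib

namespace VennKGon

/-- The Euclidean plane. -/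
abbrev Plane : Type := EuclideanSpace ℝ (Fin 2)

/-- A simple closed curve in the plane: an injective continuous image of the circle. -/
def IsSimpleClosedCurve (C : Set Plane) : Prop :=
  ∃ γ : Circle → Plane, Continuous γ ∧ Function.Injective γ ∧ Set.range γ = C

/-- The interior of a curve `C`: the points off `C` whose connected component in the complement
of `C` is bounded. -/
def inside (C : Set Plane) : Set Plane :=
  {x | x ∉ C ∧ Bornology.IsBounded (connectedComponentIn Cᶜ x)}

/-- The exterior of a curve `C`: the points off `C` whose connected component in the complement
of `C` is unbounded. -/
def outside (C : Set Plane) : Set Plane :=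
  {x | x ∉ C ∧ ¬ Bornology.IsBounded (connectedComponentIn Cᶜ x)}

/-- The region `X₁ ∩ ⋯ ∩ Xₙ`, where `Xᵢ` is the interior of `Cᵢ` for `i ∈ S` and the exterior
of `Cᵢ` for `i ∉ S`. -/
def region {n : ℕ} (C : Fin n → Set Plane) (S : Set (Fin n)) : Set Plane :=
  {x | ∀ i, (i ∈ S → x ∈ inside (C i)) ∧ (i ∉ S → x ∈ outside (C i))}

/-- A family of `n` finitely intersecting simple closed curves is an `n`-Venn diagram if all its
`2 ^ n` regions are non-empty and connected (`IsConnected` includes non-emptiness). -/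
structure IsVennDiagram {n : ℕ} (C : Fin n → Set Plane) : Prop where
  simpleClosed : ∀ i, IsSimpleClosedCurve (C i)
  finite_inter : ∀ i j, i ≠ j → (C i ∩ C j).Finite
  connected_region : ∀ S : Set (Fin n), IsConnected (region C S)

/-- `C` is (the boundary curve of) a convex polygon with exactly `k` sides: the union of the sides
of a polygon with `k ≥ 3` corners, the corners being in convex position (so that no three of them
are collinear) and the sides together forming the boundary of the convex hull of the corners. -/
def IsConvexKGon (k : ℕ) (C : Set Plane) : Prop :=
  3 ≤ k ∧ ∃ P : Polygon Plane k,
    ConvexIndependent ℝ P.vertices ∧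
    P.boundary ℝ = frontier (convexHull ℝ (Set.range P.vertices)) ∧
    C = P.boundary ℝ

/-- The vertices of a diagram: the points that lie on at least two of its curves. -/
def vertexSet {n : ℕ} (C : Fin n → Set Plane) : Set Plane :=
  {x | ∃ i j, i ≠ j ∧ x ∈ C i ∧ x ∈ C j}

end VennKGon

/-! Fix a point `p` inside all curves and describe `C i` by the gauge `g i` of its convex body about
`p`; in a given direction the outer curve is the one with the smaller gauge. The target bound equals
`n * (k * (n - 2) + 1)`, so it suffices to charge every vertex to a curve with at most `k * (n - 2)
+ 1` charges per curve.

From a common point of two curves, turn counterclockwise to their next common direction. In between,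
one curve `i` is strictly outside the other curve `j`, and it has a corner there: a straight piece
of `i` across the sector would contradict the convexity of `j` (`exists_end_mem_Ioo`). The point is
thus a departure of `i` from `j`, and the corner determines it, as the last crossing before the
corner.

Let `e` of the `k` corners of `i` be outside all other curves. Each other corner is outside at most
`n - 2` curves. The region inside `C i` alone is connected, so its directions form one arc, and for
each `j` the `e` corners lead back to the same departure (`ncard_departures_le`). The total is at
most `(k - e) * (n - 2)`, plus `n - 1` if `e > 0`, hence at most `k * (n - 2) + 1`. -/

open Real Set Filter Topology

namespace VennKGon

/-! ### Polar coordinates. -/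

/-- The unit vector of the plane at angle `t`. -/
noncomputable def dir (t : ℝ) : Plane := !₂[cos t, sin t]

@[simp] lemma dir_zero_coord (t : ℝ) : dir t 0 = cos t := rfl

@[simp] lemma dir_one_coord (t : ℝ) : dir t 1 = sin t := rfl

lemma plane_ext {x y : Plane} (h0 : x 0 = y 0) (h1 : x 1 = y 1) : x = y := by
  ext i
  fin_cases i
  · exact h0
  · exact h1

lemma continuous_dir : Continuous dir := by
  refine (PiLp.continuous_toLp 2 _).comp (continuous_pi fun i => ?_)
  fin_cases i
  · exact continuous_cos
  · exact continuous_sin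

lemma dir_ne_zero (t : ℝ) : dir t ≠ 0 := by
  intro h
  have h0 : cos t = 0 := by simpa using congrArg (fun x : Plane => x 0) h
  have h1 : sin t = 0 := by simpa using congrArg (fun x : Plane => x 1) h
  have := sin_sq_add_cos_sq t
  simp [h0, h1] at this

lemma dir_add_int (t : ℝ) (m : ℤ) : dir (t + m * (2 * π)) = dir t := by
  apply plane_ext <;> simp [cos_add_int_mul_two_pi, sin_add_int_mul_two_pi]

lemma dir_add_two_pi (t : ℝ) : dir (t + 2 * π) = dir t := by
  simpa using dir_add_int t 1

lemma exists_eq_smul_dir {x : Plane} (hx : x ≠ 0) : ∃ r : ℝ, 0 < r ∧ ∃ t, x = r • dir t := by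
  set z : ℂ := ⟨x 0, x 1⟩ with hz
  have hz0 : z ≠ 0 := by
    intro h
    apply hx
    apply plane_ext
    · simpa [hz] using congrArg Complex.re h
    · simpa [hz] using congrArg Complex.im h
  refine ⟨‖z‖, norm_pos_iff.2 hz0, z.arg, plane_ext ?_ ?_⟩
  · simp [Complex.norm_mul_cos_arg, hz]
  · simp [Complex.norm_mul_sin_arg, hz]

lemma exists_eq_smul_dir_Ioc {x : Plane} (hx : x ≠ 0) (s : ℝ) :
    ∃ r : ℝ, 0 < r ∧ ∃ t ∈ Ioc s (s + 2 * π), x = r • dir t := by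
  obtain ⟨r, hr, t, rfl⟩ := exists_eq_smul_dir hx
  refine ⟨r, hr, toIocMod two_pi_pos s t, toIocMod_mem_Ioc _ _ _, ?_⟩
  congr 1
  have h := self_sub_toIocDiv_zsmul two_pi_pos s t
  rw [← dir_add_int (toIocMod _ _ _) (toIocDiv two_pi_pos s t), ← h]
  congr 1
  simp

/-- For `z ≤ t ≤ w` within a half turn the coefficients are nonnegative, so `dir t` lies in the cone
over `dir z` and `dir w`. This is how convexity enters in angular form. -/
lemma sin_smul_dir (z t w : ℝ) :
    sin (w - z) • dir t = sin (w - t) • dir z + sin (t - z) • dir w := by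
  apply plane_ext <;> simp [sin_sub] <;> ring

lemma smul_dir_unique {r s z w : ℝ} (hr : 0 < r) (hs : 0 < s) (h : r • dir z = s • dir w) :
    r = s ∧ ∃ m : ℤ, w = z + m * (2 * π) := by
  have h0 : r * cos z = s * cos w := by simpa using congrArg (fun x : Plane => x 0) h
  have h1 : r * sin z = s * sin w := by simpa using congrArg (fun x : Plane => x 1) h
  have hsq : r ^ 2 = s ^ 2 := by
    have e1 := sin_sq_add_cos_sq z
    have e2 := sin_sq_add_cos_sq w
    calc r ^ 2 = (r * sin z) ^ 2 + (r * cos z) ^ 2 := by linear_combination -r ^ 2 * e1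
      _ = s ^ 2 := by rw [h0, h1]; linear_combination s ^ 2 * e2
  have hrs : r = s := by
    rwa [sq_eq_sq₀ hr.le hs.le] at hsq
  subst hrs
  refine ⟨rfl, ?_⟩
  have c0 := mul_left_cancel₀ hr.ne' h0
  have c1 := mul_left_cancel₀ hr.ne' h1
  have : cos (w - z) = 1 := by
    rw [cos_sub, ← c0, ← c1]; linear_combination sin_sq_add_cos_sq z
  obtain ⟨m, hm⟩ := (cos_eq_one_iff _).1 this
  exact ⟨m, by linarith⟩

/-! ### Gauges, and a corner in every sector where a polygon is the outer curve. -/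

/-- A positive-definite continuous sublinear functional on the plane. -/
structure IsGauge (g : Plane → ℝ) : Prop where
  continuous : Continuous g
  pos : ∀ x, x ≠ 0 → 0 < g x
  smul : ∀ (c : ℝ) x, 0 ≤ c → g (c • x) = c * g x
  add_le : ∀ x y, g (x + y) ≤ g x + g y

namespace IsGauge

variable {g h : Plane → ℝ}

lemma ne_zero (hg : IsGauge g) {x : Plane} (hx : g x = 1) : x ≠ 0 := by
  rintro rfl
  have := hg.smul 0 0 le_rfl
  simp [hx] at this

lemma eq_of_smul_dir (hg : IsGauge g) {r s t : ℝ} (hr : 0 < r) (hs : 0 < s)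
    (h1 : g (r • dir t) = 1) (h2 : g (s • dir t) = 1) : r = s := by
  rw [hg.smul _ _ hr.le] at h1
  rw [hg.smul _ _ hs.le] at h2
  exact mul_right_cancel₀ (hg.pos _ (dir_ne_zero t)).ne' (h1.trans h2.symm)

/-- A sublinear functional that is constant on a segment is additive on the cone over it. -/
lemma eq_add_of_segment (hg : IsGauge g) {A B : Plane} (hAB : ∀ y ∈ segment ℝ A B, g y = 1)
    {a b : ℝ} (ha : 0 ≤ a) (hb : 0 ≤ b) : g (a • A + b • B) = a + b := by
  rcases (add_nonneg ha hb).eq_or_lt with h | h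
  · have ha0 : a = 0 := by linarith
    have hb0 : b = 0 := by linarith
    have := hg.smul 0 0 le_rfl
    simpa [ha0, hb0] using this
  · have hy := hAB ((a / (a + b)) • A + (b / (a + b)) • B)
      ⟨a / (a + b), b / (a + b), by positivity, by positivity, by field_simp, rfl⟩
    have := hg.smul (a + b) _ h.le ▸ congrArg (fun q => (a + b) * q) hy
    rw [smul_add, smul_smul, smul_smul, mul_div_cancel₀ _ h.ne',
      mul_div_cancel₀ _ h.ne'] at this
    simpa using this

/-- Two consecutive sign changes of `h - g` that enclose a piece of the unit curve of `g` outside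
that of `h` enclose an end of a segment of the former curve (ordered ends). -/
lemma exists_end_of_lt (hg : IsGauge g) (hh : IsGauge h) {A B : Plane}
    (hAB : ∀ y ∈ segment ℝ A B, g y = 1) {z t w a b α β : ℝ} (hzt : z < t) (htw : t < w)
    (hz : g (dir z) = h (dir z)) (hw : g (dir w) = h (dir w)) (ht : g (dir t) < h (dir t))
    (ha : 0 < a) (hb : 0 < b) (hA : A = a • dir α) (hB : B = b • dir β)
    (hαt : α < t) (htβ : t < β) (hβα : β - α < π) :
    z < α ∨ β < w := by
  by_contra! hcon
  obtain ⟨hαz, hwβ⟩ := hcon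
  have hS : 0 < sin (β - α) := sin_pos_of_pos_of_lt_pi (by linarith) hβα
  have hs : 0 < sin (w - z) := sin_pos_of_pos_of_lt_pi (by linarith) (by linarith)
  -- Otherwise the sector from `z` to `w` lies in the cone over `A` and `B`, where `g` is additive.
  -- Subadditivity of `h` then gives `h (dir t) ≤ g (dir t)`.
  have key : ∀ q, α ≤ q → q ≤ β → ∃ c d : ℝ, 0 ≤ c ∧ 0 ≤ d ∧ dir q = c • A + d • B := by
    intro q h1 h2
    refine ⟨sin (β - q) / sin (β - α) / a, sin (q - α) / sin (β - α) / b, ?_, ?_, ?_⟩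
    · have := sin_nonneg_of_nonneg_of_le_pi (x := β - q) (by linarith) (by linarith)
      positivity
    · have := sin_nonneg_of_nonneg_of_le_pi (x := q - α) (by linarith) (by linarith)
      positivity
    · have := sin_smul_dir α q β
      rw [hA, hB, smul_smul, smul_smul, div_mul_cancel₀ _ ha.ne', div_mul_cancel₀ _ hb.ne',
        div_eq_inv_mul, div_eq_inv_mul, mul_smul, mul_smul, ← smul_add, ← this, smul_smul,
        inv_mul_cancel₀ hS.ne', one_smul]
  obtain ⟨c, d, hc, hd, e1⟩ := key z hαz (by linarith)
  obtain ⟨c', d', hc', hd', e2⟩ := key w (by linarith) hwβ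
  have p1 : 0 ≤ sin (w - t) := sin_nonneg_of_nonneg_of_le_pi (by linarith) (by linarith)
  have p2 : 0 ≤ sin (t - z) := sin_nonneg_of_nonneg_of_le_pi (by linarith) (by linarith)
  have hcomb := sin_smul_dir z t w
  have hgt : sin (w - z) * g (dir t) = sin (w - t) * g (dir z) + sin (t - z) * g (dir w) := by
    rw [← hg.smul _ _ hs.le, hcomb, e1, e2, hg.eq_add_of_segment hAB hc hd,
      hg.eq_add_of_segment hAB hc' hd']
    rw [show sin (w - t) • (c • A + d • B) + sin (t - z) • (c' • A + d' • B)
      = (sin (w - t) * c + sin (t - z) * c') • A + (sin (w - t) * d + sin (t - z) * d') • B by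
        module, hg.eq_add_of_segment hAB (by positivity) (by positivity)]
    ring
  have hht : sin (w - z) * h (dir t) ≤ sin (w - t) * h (dir z) + sin (t - z) * h (dir w) := by
    rw [← hh.smul _ _ hs.le, hcomb, ← hh.smul _ _ p1, ← hh.smul _ _ p2]
    exact hh.add_le _ _
  rw [← hz, ← hw, ← hgt] at hht
  exact absurd (le_of_mul_le_mul_left hht hs) (not_le.2 ht)

/-- Measured from the opposite of `dir t`, the angles of the two ends must lie strictly on either
side of `t`, less than a half turn apart, because the segment crosses the ray at `t`; this reduces
to `exists_end_of_lt`. There is no bound on `w - z`, so a full turn between crossings is covered. -/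
lemma exists_end_mem_Ioo (hg : IsGauge g) (hh : IsGauge h) {A B : Plane}
    (hAB : ∀ y ∈ segment ℝ A B, g y = 1) {z t w r : ℝ} (hzt : z < t) (htw : t < w)
    (hz : g (dir z) = h (dir z)) (hw : g (dir w) = h (dir w)) (ht : g (dir t) < h (dir t))
    (hr : 0 < r) (hx : r • dir t ∈ segment ℝ A B) :
    (∃ a : ℝ, 0 < a ∧ ∃ c ∈ Ioo z w, A = a • dir c) ∨
      (∃ b : ℝ, 0 < b ∧ ∃ c ∈ Ioo z w, B = b • dir c) := by
  have hA0 := hg.ne_zero (hAB A (left_mem_segment ℝ A B))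
  have hB0 := hg.ne_zero (hAB B (right_mem_segment ℝ A B))
  obtain ⟨a, ha, α, hα, hA⟩ := exists_eq_smul_dir_Ioc hA0 (t - π)
  obtain ⟨b, hb, β, hβ, hB⟩ := exists_eq_smul_dir_Ioc hB0 (t - π)
  by_contra! hcon
  have hAn : α ∉ Ioo z w := fun hm => hcon.1 a ha α hm hA
  have hBn : β ∉ Ioo z w := fun hm => hcon.2 b hb β hm hB
  have hαt : α ≠ t := fun e => hAn (e ▸ ⟨hzt, htw⟩)
  have hβt : β ≠ t := fun e => hBn (e ▸ ⟨hzt, htw⟩)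
  obtain ⟨l, m, hl, hm, hlm, hx⟩ := hx
  -- `h0` and `h1` are the components of the crossing point along and across `dir t`.
  have h0 : l * a * cos (α - t) + m * b * cos (β - t) = r := by
    have e0 : l * (a * cos α) + m * (b * cos β) = r * cos t := by
      simpa [hA, hB] using congrArg (fun x : Plane => x 0) hx
    have e1 : l * (a * sin α) + m * (b * sin β) = r * sin t := by
      simpa [hA, hB] using congrArg (fun x : Plane => x 1) hx
    rw [cos_sub, cos_sub]
    linear_combination cos t * e0 + sin t * e1 + r * sin_sq_add_cos_sq t
  have h1 : l * a * sin (α - t) + m * b * sin (β - t) = 0 := by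
    have e0 : l * (a * cos α) + m * (b * cos β) = r * cos t := by
      simpa [hA, hB] using congrArg (fun x : Plane => x 0) hx
    have e1 : l * (a * sin α) + m * (b * sin β) = r * sin t := by
      simpa [hA, hB] using congrArg (fun x : Plane => x 1) hx
    rw [sin_sub, sin_sub]
    linear_combination cos t * e1 - sin t * e0
  have hsign : ∀ θ ∈ Ioc (t - π) (t - π + 2 * π), θ ≠ t →
      (θ < t ∧ sin (θ - t) < 0) ∨ (t < θ ∧ 0 < sin (θ - t)) ∨
        (sin (θ - t) = 0 ∧ cos (θ - t) = -1) := by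
    intro θ hθ hne
    rcases lt_or_gt_of_ne hne with h | h
    · exact Or.inl ⟨h, sin_neg_of_neg_of_neg_pi_lt (by linarith) (by linarith [hθ.1])⟩
    · rcases (show θ - t ≤ π by linarith [hθ.2]).eq_or_lt with h' | h'
      · right; right; simp [h']
      · exact Or.inr (Or.inl ⟨h, sin_pos_of_pos_of_lt_pi (by linarith) h'⟩)
  have hla : 0 ≤ l * a := by positivity
  have hmb : 0 ≤ m * b := by positivity
  -- the angle between the two ends is less than a half turn
  have hgap : ∀ α β l m : ℝ, 0 ≤ l → 0 ≤ m → l * cos (α - t) + m * cos (β - t) = r →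
      l * sin (α - t) + m * sin (β - t) = 0 → sin (α - t) < 0 → 0 < sin (β - t) →
      t - π < α → α < t → β ≤ t + π → β - α < π := by
    intro α β l m hl hm h0 h1 s1 s2 a1 a2 b1
    by_contra! hge
    have e : m * sin (β - α) = r * -sin (α - t) := by
      rw [← h0, show β - α = (β - t) - (α - t) by ring, sin_sub]
      linear_combination cos (α - t) * h1
    have : 0 < m * sin (β - α) := e ▸ mul_pos hr (by linarith)
    have : sin (β - α) ≤ 0 := by
      have := sin_nonneg_of_nonneg_of_le_pi (x := β - α - π) (by linarith) (by linarith)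
      rw [sin_sub_pi] at this
      linarith
    nlinarith
  rcases hsign α hα hαt with ⟨c1, s1⟩ | ⟨c1, s1⟩ | ⟨s1, c1⟩ <;>
  rcases hsign β hβ hβt with ⟨c2, s2⟩ | ⟨c2, s2⟩ | ⟨s2, c2⟩
  case inl.inr.inl =>
    have hπ := hgap α β _ _ hla hmb h0 h1 s1 s2 hα.1 c1 (by linarith [hβ.2])
    rcases hg.exists_end_of_lt hh hAB hzt htw hz hw ht ha hb hA hB c1 c2 hπ with h | h
    · exact hAn ⟨h, by linarith⟩
    · exact hBn ⟨by linarith, h⟩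
  case inr.inl.inl =>
    have hπ := hgap β α _ _ hmb hla (by linarith) (by linarith) s2 s1 hβ.1 c2 (by linarith [hα.2])
    rcases hg.exists_end_of_lt hh (segment_symm ℝ A B ▸ hAB) hzt htw hz hw ht hb ha hB hA c2 c1 hπ
      with h | h
    · exact hBn ⟨h, by linarith⟩
    · exact hAn ⟨by linarith, h⟩
  all_goals
    -- the weights vanish on the coordinates of a strict sign, and the rest points away from `t`
    first
    | (rw [s1, s2] at h1; rw [c1, c2] at h0; linarith)
    | (have hm0 : m * b = 0 := by
        rw [s1] at h1
        rcases mul_eq_zero.1 (show m * b * sin (β - t) = 0 by linarith) with h | h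
        · exact h
        · exact absurd h (by first | exact s2.ne | exact s2.ne')
       rw [hm0, c1] at h0; linarith)
    | (have hl0 : l * a = 0 := by
        rw [s2] at h1
        rcases mul_eq_zero.1 (show l * a * sin (α - t) = 0 by linarith) with h | h
        · exact h
        · exact absurd h (by first | exact s1.ne | exact s1.ne')
       rw [hl0, c2] at h0; linarith)
    | (have hl0 : l * a = 0 := by
        by_contra hne
        have := lt_of_le_of_ne hla (Ne.symm hne)
        first
        | nlinarith [mul_pos this s1, mul_nonneg hmb s2.le]
        | nlinarith [mul_pos this (neg_pos.2 s1), mul_nonneg hmb (neg_nonneg.2 s2.le)]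
       have hm0 : m * b = 0 := by
        rw [hl0] at h1
        rcases mul_eq_zero.1 (show m * b * sin (β - t) = 0 by linarith) with h | h
        · exact h
        · exact absurd h (by first | exact s2.ne | exact s2.ne')
       rw [hl0, hm0] at h0; linarith)

end IsGauge

/-! ### Consecutive crossings of two curves. -/

/-- A zero of a continuous function with finitely many zeros in a period is followed by a
next one. -/
lemma exists_next_zero {H : ℝ → ℝ} {z T : ℝ} (hT : 0 < T) (hper : H (z + T) = H z)
    (hfin : {t ∈ Ioc z (z + T) | H t = 0}.Finite) (hz : H z = 0) :
    ∃ w, z < w ∧ H w = 0 ∧ ∀ t ∈ Ioo z w, H t ≠ 0 := by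
  -- By periodicity `z + T` is itself a zero; it is the next one if there is no other.
  obtain ⟨w, hw, hmin⟩ := hfin.exists_minimal ⟨z + T, ⟨by linarith, le_rfl⟩, hper.trans hz⟩
  refine ⟨w, hw.1.1, hw.2, fun t ht h0 => ?_⟩
  exact absurd (hmin ⟨⟨ht.1, ht.2.le.trans hw.1.2⟩, h0⟩ ht.2.le) (not_le.2 ht.2)

lemma sign_on_Ioo {H : ℝ → ℝ} (hH : Continuous H) {z w : ℝ} (hne : ∀ t ∈ Ioo z w, H t ≠ 0) :
    (∀ t ∈ Ioo z w, 0 < H t) ∨ (∀ t ∈ Ioo z w, H t < 0) := by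
  by_contra! hcon
  obtain ⟨⟨s, hs, hs0⟩, ⟨t, ht, ht0⟩⟩ := hcon
  obtain ⟨q, hq, hq0⟩ := isPreconnected_Ioo.intermediate_value hs ht hH.continuousOn ⟨hs0, ht0⟩
  exact hne q hq hq0

/-- In direction `t + ε` after the common point `x` of the unit curves of `g` and `h`, and on to
direction `c`, the unit curve of `g` is the outer one. -/
def IsOuterFrom (g h : Plane → ℝ) (x : Plane) (c : ℝ) : Prop :=
  ∃ z s : ℝ, 0 < s ∧ x = s • dir z ∧ z < c ∧ g (dir z) = h (dir z) ∧
    ∀ t ∈ Ioc z c, g (dir t) < h (dir t)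

namespace IsOuterFrom

variable {g h : Plane → ℝ} {x y : Plane} {c c' : ℝ}

lemma add_int (hx : IsOuterFrom g h x c) (m : ℤ) : IsOuterFrom g h x (c + m * (2 * π)) := by
  obtain ⟨z, s, hs, rfl, hzc, hz, hlt⟩ := hx
  refine ⟨z + m * (2 * π), s, hs, by rw [dir_add_int], by linarith, by rwa [dir_add_int], ?_⟩
  intro t ht
  have := hlt (t - m * (2 * π)) ⟨by linarith [ht.1], by linarith [ht.2]⟩
  rwa [← dir_add_int _ m, sub_add_cancel] at this

lemma extend (hx : IsOuterFrom g h x c) (hcc : c ≤ c')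
    (hlt : ∀ t ∈ Icc c c', g (dir t) < h (dir t)) : IsOuterFrom g h x c' := by
  obtain ⟨z, s, hs, rfl, hzc, hz, hlt'⟩ := hx
  refine ⟨z, s, hs, rfl, hzc.trans_le hcc, hz, fun t ht => ?_⟩
  rcases le_total t c with h1 | h1
  · exact hlt' t ⟨ht.1, h1⟩
  · exact hlt t ⟨h1, ht.2⟩

lemma lt (hx : IsOuterFrom g h x c) : g (dir c) < h (dir c) := by
  obtain ⟨z, s, hs, rfl, hzc, hz, hlt⟩ := hx
  exact hlt c ⟨hzc, le_rfl⟩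

/-- Both points sit at the last crossing before `c`: the later of two distinct crossings would lie
where `g < h`. -/
lemma unique (hg : IsGauge g) (hx : IsOuterFrom g h x c) (hy : IsOuterFrom g h y c)
    (hx1 : g x = 1) (hy1 : g y = 1) : x = y := by
  obtain ⟨z, s, hs, rfl, hzc, hz, hlt⟩ := hx
  obtain ⟨z', s', hs', rfl, hzc', hz', hlt'⟩ := hy
  obtain rfl : z = z' := by
    rcases lt_trichotomy z z' with h1 | h1 | h1
    · exact absurd hz' (hlt z' ⟨h1, hzc'.le⟩).ne
    · exact h1
    · exact absurd hz (hlt' z ⟨h1, hzc.le⟩).ne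
  rw [hg.eq_of_smul_dir hs hs' hx1 hy1]

/-- Without a crossing on the arc between the two corners, both look back to the same last crossing.
The integer `m` selects one of the arcs. -/
lemma unique_of_uIcc (hg : IsGauge g) (hx : IsOuterFrom g h x c) (hy : IsOuterFrom g h y c')
    (hx1 : g x = 1) (hy1 : g y = 1) {m : ℤ}
    (hlt : ∀ t ∈ uIcc c (c' + m * (2 * π)), g (dir t) < h (dir t)) : x = y := by
  have hy' := hy.add_int m
  rcases le_total c (c' + m * (2 * π)) with h1 | h1
  · rw [uIcc_of_le h1] at hlt
    exact unique hg (hx.extend h1 hlt) hy' hx1 hy1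
  · rw [uIcc_of_ge h1] at hlt
    exact unique hg hx (hy'.extend h1 hlt) hx1 hy1

end IsOuterFrom

/-- The unit curve of `g` is a union of segments with ends among the points `v a`. -/
def IsPolygonal {ι : Type*} (g : Plane → ℝ) (v : ι → Plane) : Prop :=
  ∀ x, g x = 1 → ∃ a b, x ∈ segment ℝ (v a) (v b) ∧ ∀ y ∈ segment ℝ (v a) (v b), g y = 1

lemma exists_corner {ι : Type*} {g h : Plane → ℝ} {v : ι → Plane} (hg : IsGauge g)
    (hh : IsGauge h) (hv : IsPolygonal g v) {z w s : ℝ} (hzw : z < w) (hs : 0 < s)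
    (hz : g (dir z) = h (dir z)) (hw : g (dir w) = h (dir w))
    (hlt : ∀ t ∈ Ioo z w, g (dir t) < h (dir t)) :
    ∃ a c, ∃ r : ℝ, 0 < r ∧ v a = r • dir c ∧ IsOuterFrom g h (s • dir z) c := by
  have hpos := hg.pos _ (dir_ne_zero ((z + w) / 2))
  have hmid : (z + w) / 2 ∈ Ioo z w := ⟨by linarith, by linarith⟩
  obtain ⟨a, b, hx, hseg⟩ := hv ((g (dir ((z + w) / 2)))⁻¹ • dir ((z + w) / 2)) (by
    rw [hg.smul _ _ (by positivity), inv_mul_cancel₀ hpos.ne'])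
  have hfin : ∀ c ∈ Ioo z w, IsOuterFrom g h (s • dir z) c := fun c hc =>
    ⟨z, s, hs, rfl, hc.1, hz, fun t ht => hlt t ⟨ht.1, ht.2.trans_lt hc.2⟩⟩
  rcases hg.exists_end_mem_Ioo hh hseg hmid.1 hmid.2 hz hw (hlt _ hmid) (by positivity) hx with
    ⟨r, hr, c, hc, e⟩ | ⟨r, hr, c, hc, e⟩
  · exact ⟨a, c, r, hr, e, hfin c hc⟩
  · exact ⟨b, c, r, hr, e, hfin c hc⟩

lemma exists_corner_of_common {ι κ : Type*} {g h : Plane → ℝ} {v : ι → Plane} {u : κ → Plane}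
    (hg : IsGauge g) (hh : IsGauge h) (hv : IsPolygonal g v) (hu : IsPolygonal h u)
    (hfin : {x | g x = 1 ∧ h x = 1}.Finite) {x : Plane} (hx : g x = 1) (hx' : h x = 1) :
    (∃ a c, ∃ r : ℝ, 0 < r ∧ v a = r • dir c ∧ IsOuterFrom g h x c) ∨
      (∃ a c, ∃ r : ℝ, 0 < r ∧ u a = r • dir c ∧ IsOuterFrom h g x c) := by
  obtain ⟨s, hs, z, rfl⟩ := exists_eq_smul_dir (hg.ne_zero hx)
  rw [hg.smul _ _ hs.le] at hx
  rw [hh.smul _ _ hs.le] at hx'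
  have hz : g (dir z) = h (dir z) := mul_left_cancel₀ hs.ne' (hx.trans hx'.symm)
  have hcont : Continuous fun t => h (dir t) - g (dir t) :=
    (hh.continuous.comp continuous_dir).sub (hg.continuous.comp continuous_dir)
  obtain ⟨w, hzw, hw, hne⟩ := exists_next_zero (H := fun t => h (dir t) - g (dir t))
    (z := z) two_pi_pos (by simp [dir_add_two_pi]) (by
      -- Zeros in a half-open period correspond injectively to common points of the unit curves.
      refine Finite.of_injOn (f := fun t => (g (dir t))⁻¹ • dir t) ?_ ?_ hfin
      · intro t ht
        have hpos := hg.pos _ (dir_ne_zero t)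
        have e : h (dir t) = g (dir t) := sub_eq_zero.1 ht.2
        constructor
        · rw [hg.smul _ _ (by positivity), inv_mul_cancel₀ hpos.ne']
        · rw [hh.smul _ _ (by positivity), e, inv_mul_cancel₀ hpos.ne']
      · intro t ht t' ht' e
        have hpos := hg.pos _ (dir_ne_zero t)
        have hpos' := hg.pos _ (dir_ne_zero t')
        obtain ⟨-, m, hm⟩ := smul_dir_unique (inv_pos.2 hpos) (inv_pos.2 hpos') e
        have hp := two_pi_pos
        have h1 : (m : ℝ) < 1 := by
          by_contra! hcon
          nlinarith [ht.1.1, ht'.1.2]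
        have h2 : (-1 : ℝ) < m := by
          by_contra! hcon
          nlinarith [ht.1.2, ht'.1.1]
        have h1' : m < 1 := by exact_mod_cast h1
        have h2' : -1 < m := by exact_mod_cast h2
        obtain rfl : m = 0 := by omega
        simpa using hm.symm) (by simp [hz])
  have hw' : g (dir w) = h (dir w) := (sub_eq_zero.1 hw).symm
  rcases sign_on_Ioo hcont hne with hlt | hlt
  · exact Or.inl (exists_corner hg hh hv hzw hs hz hw' fun t ht => sub_pos.1 (hlt t ht))
  · exact Or.inr (exists_corner hh hg hu hzw hs hz.symm hw'.symm fun t ht => sub_neg.1 (hlt t ht))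

/-! ### Connected regions seen from the origin. -/

lemma norm_smul_dir {r : ℝ} (hr : 0 < r) (t : ℝ) : ‖r • dir t‖ = r := by
  have : ‖dir t‖ = 1 := by
    rw [EuclideanSpace.norm_eq]
    simp
  rw [norm_smul, this, mul_one, Real.norm_of_nonneg hr.le]

/-- The set of directions of a connected set off the origin is connected. -/
lemma exists_uIcc_subset_of_isPreconnected {R : Set Plane} {Θ : Set ℝ} (hR : IsPreconnected R)
    (h0 : (0 : Plane) ∉ R) (hRΘ : ∀ r t : ℝ, 0 < r → r • dir t ∈ R → t ∈ Θ)
    (hΘR : ∀ t ∈ Θ, ∃ r : ℝ, 0 < r ∧ r • dir t ∈ R) {α β : ℝ} (hα : α ∈ Θ) (hβ : β ∈ Θ) :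
    ∃ m : ℤ, ∀ t ∈ uIcc α (β + m * (2 * π)), t ∈ Θ := by
  have hper : ∀ t ∈ Θ, ∀ m : ℤ, t + m * (2 * π) ∈ Θ := by
    intro t ht m
    obtain ⟨r, hr, hrt⟩ := hΘR t ht
    exact hRΘ r _ hr (by rwa [dir_add_int])
  obtain ⟨m, hm1, hm2⟩ : ∃ m : ℤ, α < β + m * (2 * π) ∧ β + m * (2 * π) ≤ α + 2 * π := by
    have h := self_sub_toIocDiv_zsmul two_pi_pos α β
    have h' := toIocMod_mem_Ioc two_pi_pos α β
    refine ⟨-toIocDiv two_pi_pos α β, ?_⟩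
    rw [← h] at h'
    simpa [sub_eq_add_neg] using h'
  have hβ' := hper β hβ m
  set γ := β + m * (2 * π) with hγ
  by_contra! hcon
  -- The integers `m` and `m - 1` give the two arcs joining the directions `α` and `β`; each
  -- contains a missing direction, `s` or `s'`.
  obtain ⟨s, hs, hsΘ⟩ := hcon m
  obtain ⟨s', hs', hsΘ'⟩ := hcon (m - 1)
  have e : β + ((m - 1 : ℤ) : ℝ) * (2 * π) = γ - 2 * π := by push_cast; ring
  rw [← hγ, uIcc_of_le hm1.le] at hs
  rw [e, uIcc_of_ge (by linarith)] at hs'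
  have hαs : α < s := lt_of_le_of_ne hs.1 fun e => hsΘ (e ▸ hα)
  have hsγ : s < γ := lt_of_le_of_ne hs.2 fun e => hsΘ (e ▸ hβ')
  have hsα' : s' < α := lt_of_le_of_ne hs'.2 fun e => hsΘ' (e ▸ hα)
  have hγs' : γ - 2 * π < s' := by
    refine lt_of_le_of_ne hs'.1 fun e => hsΘ' ?_
    have := hper γ hβ' (-1)
    rw [← e]
    convert this using 1
    push_cast; ring
  -- The rays at `s = μ - η` and `s' + 2 * π = μ + η` cut the plane into two sectors. `F` vanishes
  -- on these rays, is positive in the sector of `γ` and negative in that of `α`, so a connected `R`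
  -- would have to meet one of them.
  set μ := (s + (s' + 2 * π)) / 2 with hμ
  set η := ((s' + 2 * π) - s) / 2 with hη
  set F : Plane → ℝ := fun x => x 0 * cos μ + x 1 * sin μ - ‖x‖ * cos η with hF
  have hFc : Continuous F := by fun_prop
  have hFdir : ∀ r t : ℝ, 0 < r → F (r • dir t) = r * (cos (t - μ) - cos η) := by
    intro r t hr
    simp only [hF, norm_smul_dir hr, cos_sub]
    simp
    ring
  obtain ⟨r, hr, hrα⟩ := hΘR α hα
  obtain ⟨q, hq, hqγ⟩ := hΘR γ hβ'
  have n1 : F (r • dir α) ≤ 0 := by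
    rw [hFdir r α hr]
    have : cos (α - μ) < cos η := by
      rw [← cos_neg (α - μ)]
      rcases le_total (-(α - μ)) π with h1 | h1
      · exact cos_lt_cos_of_nonneg_of_le_pi (by linarith) h1 (by linarith)
      · rw [← cos_two_pi_sub (-(α - μ))]
        exact cos_lt_cos_of_nonneg_of_le_pi (by linarith) (by linarith) (by linarith)
    nlinarith
  have n2 : 0 ≤ F (q • dir γ) := by
    rw [hFdir q γ hq]
    have : cos η < cos (γ - μ) := by
      rw [← cos_abs (γ - μ)]
      exact cos_lt_cos_of_nonneg_of_le_pi (abs_nonneg _) (by linarith)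
        (abs_lt.2 ⟨by linarith, by linarith⟩)
    nlinarith
  obtain ⟨x, hxR, hx⟩ := hR.intermediate_value hrα hqγ hFc.continuousOn ⟨n1, n2⟩
  obtain ⟨l, hl, t, rfl⟩ := exists_eq_smul_dir (x := x) fun e => h0 (e ▸ hxR)
  have ht := hRΘ l t hl hxR
  rw [hFdir l t hl] at hx
  have hcos : cos η = cos (t - μ) := by
    rcases mul_eq_zero.1 hx with h | h <;> linarith
  obtain ⟨a, ha | ha⟩ := Real.cos_eq_cos_iff.1 hcos
  · apply hsΘ'
    have := hper t ht (-a - 1)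
    convert this using 1
    push_cast
    linarith
  · apply hsΘ
    have := hper t ht (-a)
    convert this using 1
    push_cast
    linarith

/-! ### Counting departures in a family of curves. -/

section Family

variable {n k : ℕ} {g : Fin n → Plane → ℝ} {v : Fin n → Fin k → Plane}

/-- The directions in which the curve with index `i` is outside all others. -/
def outerDirections (g : Fin n → Plane → ℝ) (i : Fin n) : Set ℝ :=
  {t | ∀ j, j ≠ i → g i (dir t) < g j (dir t)}

lemma exists_uIcc_subset_outerDirections (hn : 2 ≤ n) (hg : ∀ i, IsGauge (g i)) {i : Fin n}
    (hR : IsPreconnected {x | g i x < 1 ∧ ∀ j, j ≠ i → 1 < g j x}) {α β : ℝ}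
    (hα : α ∈ outerDirections g i) (hβ : β ∈ outerDirections g i) :
    ∃ m : ℤ, ∀ t ∈ uIcc α (β + m * (2 * π)), t ∈ outerDirections g i := by
  have : Nontrivial (Fin n) := Fin.nontrivial_iff_two_le.2 hn
  refine exists_uIcc_subset_of_isPreconnected hR ?_ ?_ ?_ hα hβ
  · rintro ⟨-, h⟩
    obtain ⟨j, hj⟩ := exists_ne i
    have h1 := h j hj
    have h2 := (hg j).smul 0 0 le_rfl
    simp only [zero_smul, zero_mul] at h2
    linarith
  · rintro r t hr ⟨h1, h2⟩ j hj
    have h3 := h2 j hj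
    rw [(hg i).smul _ _ hr.le] at h1
    rw [(hg j).smul _ _ hr.le] at h3
    exact lt_of_mul_lt_mul_left (h1.trans h3) hr.le
  · intro t ht
    have hpos := (hg i).pos _ (dir_ne_zero t)
    -- A point just inside the curve `i` is still outside all the others.
    have hev : ∀ᶠ r in 𝓝[<] (g i (dir t))⁻¹,
        (0 < r ∧ r < (g i (dir t))⁻¹) ∧ ∀ j, j ≠ i → 1 < r * g j (dir t) := by
      refine (Filter.Eventually.and ?_ self_mem_nhdsWithin).and (eventually_all.2 fun j => ?_)
      · exact mem_nhdsWithin_of_mem_nhds (lt_mem_nhds (inv_pos.2 hpos))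
      · by_cases hj : j = i
        · simp [hj]
        · have hc : ContinuousAt (fun r : ℝ => r * g j (dir t)) (g i (dir t))⁻¹ := by fun_prop
          have : (1 : ℝ) < (g i (dir t))⁻¹ * g j (dir t) := by
            rw [inv_mul_eq_div, one_lt_div hpos]
            exact ht j hj
          exact mem_nhdsWithin_of_mem_nhds ((hc.eventually (lt_mem_nhds this)).mono fun r h _ => h)
    obtain ⟨r, ⟨hr, hr1⟩, hr2⟩ := hev.exists
    refine ⟨r, hr, ?_, fun j hj => ?_⟩
    · rw [(hg i).smul _ _ hr.le]
      calc r * g i (dir t) < (g i (dir t))⁻¹ * g i (dir t) := by gcongr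
        _ = 1 := inv_mul_cancel₀ hpos.ne'
    · rw [(hg j).smul _ _ hr.le]
      exact hr2 j hj

/-- The common points of two curves after which the first one is outside the second one up to
some corner. -/
def departures (g : Fin n → Plane → ℝ) (v : Fin n → Fin k → Plane) (i j : Fin n) : Set Plane :=
  {x | (g i x = 1 ∧ g j x = 1) ∧
    ∃ a c, ∃ r : ℝ, 0 < r ∧ v i a = r • dir c ∧ IsOuterFrom (g i) (g j) x c}

open Classical in
/-- The corners of the curve `i` outside the curve `j`. -/
noncomputable def cornersOutside (g : Fin n → Plane → ℝ) (v : Fin n → Fin k → Plane)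
    (i j : Fin n) : Finset (Fin k) :=
  {a | g i (v i a) < g j (v i a)}

open Classical in
/-- The corners of the curve `i` outside all other curves. -/
noncomputable def exposedCorners (g : Fin n → Plane → ℝ) (v : Fin n → Fin k → Plane)
    (i : Fin n) : Finset (Fin k) :=
  {a | ∀ j, j ≠ i → g i (v i a) < g j (v i a)}

/-- Departures inject into the corners of `i` outside `j`, with all exposed corners merged into one:
the exposed corners lie in a single arc on which `i` is outermost. -/
lemma ncard_departures_le (hn : 2 ≤ n) (hg : ∀ i, IsGauge (g i)) {i j : Fin n} (hij : j ≠ i)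
    (hR : IsPreconnected {x | g i x < 1 ∧ ∀ j, j ≠ i → 1 < g j x}) :
    (departures g v i j).ncard ≤ (cornersOutside g v i j \ exposedCorners g v i).card +
      min (exposedCorners g v i).card 1 := by
  classical
  set O := cornersOutside g v i j
  set E := exposedCorners g v i
  have hdir : ∀ {a c} {r : ℝ}, 0 < r → v i a = r • dir c → a ∈ E → c ∈ outerDirections g i := by
    intro a c r hr e ha l hl
    have := (Finset.mem_filter.1 ha).2 l hl
    rw [e, (hg i).smul _ _ hr.le, (hg l).smul _ _ hr.le] at this
    exact lt_of_mul_lt_mul_left this hr.le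
  have hO : ∀ {a c x} {r : ℝ}, 0 < r → v i a = r • dir c → IsOuterFrom (g i) (g j) x c →
      a ∈ O := by
    intro a c x r hr e hx
    refine Finset.mem_filter.2 ⟨Finset.mem_univ _, ?_⟩
    rw [e, (hg i).smul _ _ hr.le, (hg j).smul _ _ hr.le]
    exact mul_lt_mul_of_pos_left hx.lt hr
  -- Here `none` stands for the merged exposed corners and `some b` for an unexposed corner `b`.
  have hex : ∀ x : Plane, ∃ a : Option (Fin k), x ∈ departures g v i j →
      ∃ b c, ∃ r : ℝ, 0 < r ∧ v i b = r • dir c ∧ IsOuterFrom (g i) (g j) x c ∧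
        ((b ∈ E ∧ a = none) ∨ (b ∉ E ∧ a = some b)) := by
    intro x
    by_cases hx : x ∈ departures g v i j
    · obtain ⟨-, b, c, r, hr, e, ho⟩ := hx
      by_cases hb : b ∈ E
      · exact ⟨none, fun _ => ⟨b, c, r, hr, e, ho, Or.inl ⟨hb, rfl⟩⟩⟩
      · exact ⟨some b, fun _ => ⟨b, c, r, hr, e, ho, Or.inr ⟨hb, rfl⟩⟩⟩
    · exact ⟨none, fun h => absurd h hx⟩
  choose φ hφ using hex
  set T : Finset (Option (Fin k)) :=
    (O \ E).map Function.Embedding.some ∪ if E.Nonempty then {none} else ∅ with hT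
  have hcard : T.card ≤ (O \ E).card + min E.card 1 := by
    refine (Finset.card_union_le _ _).trans ?_
    rw [Finset.card_map]
    gcongr
    split_ifs with h
    · simpa using h
    · simp
  rw [← ncard_coe_finset] at hcard
  refine (ncard_le_ncard_of_injOn φ ?_ ?_ T.finite_toSet).trans hcard
  · intro x hx
    obtain ⟨b, c, r, hr, e, ho, ⟨hb, h⟩ | ⟨hb, h⟩⟩ := hφ x hx
    · have hE : E.Nonempty := ⟨b, hb⟩
      simp [hT, h, hE]
    · have hbO := hO hr e ho
      simp [hT, h, hbO, hb]
  · intro x hx y hy hxy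
    obtain ⟨b, c, r, hr, e, ho, h⟩ := hφ x hx
    obtain ⟨b', c', r', hr', e', ho', h'⟩ := hφ y hy
    rw [← hxy] at h'
    rcases h with ⟨hb, h⟩ | ⟨hb, h⟩ <;> rcases h' with ⟨hb', h'⟩ | ⟨hb', h'⟩
    · obtain ⟨m, hm⟩ := exists_uIcc_subset_outerDirections hn hg hR (hdir hr e hb) (hdir hr' e' hb')
      exact ho.unique_of_uIcc (hg i) ho' hx.1.1 hy.1.1 fun t ht => hm t ht j hij
    · simp [h] at h'
    · simp [h] at h'
    -- The same corner may be reached with angles that differ by full turns.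
    · obtain rfl : b = b' := by simpa [h] using h'
      obtain ⟨-, m, hm⟩ := smul_dir_unique hr hr' (e.symm.trans e')
      have := (ho.add_int m)
      rw [← hm] at this
      exact this.unique (hg i) ho' hx.1.1 hy.1.1

/-- Double counting of pairs of an unexposed corner and a curve that it is outside of; the merged
exposed corners add at most one for each `j`. -/
lemma sum_ncard_departures_le (hn : 2 ≤ n) (hg : ∀ i, IsGauge (g i)) (i : Fin n)
    (hR : IsPreconnected {x | g i x < 1 ∧ ∀ j, j ≠ i → 1 < g j x}) :
    ∑ j ∈ Finset.univ.erase i, (departures g v i j).ncard ≤ k * (n - 2) + 1 := by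
  classical
  set E := exposedCorners g v i with hE
  have h1 : ∑ j ∈ Finset.univ.erase i, (cornersOutside g v i j \ E).card ≤ (k - E.card) * (n - 2) :=
    calc ∑ j ∈ Finset.univ.erase i, (cornersOutside g v i j \ E).card
        = ∑ j ∈ Finset.univ.erase i, ∑ a ∈ Eᶜ, if a ∈ cornersOutside g v i j then 1 else 0 := by
          refine Finset.sum_congr rfl fun j _ => ?_
          rw [← Finset.card_filter]
          congr 1
          ext a
          simp [and_comm]
      _ = ∑ a ∈ Eᶜ, ((Finset.univ.erase i).filter fun j => a ∈ cornersOutside g v i j).card := by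
          rw [Finset.sum_comm]
          exact Finset.sum_congr rfl fun a _ => (Finset.card_filter _ _).symm
      _ ≤ ∑ a ∈ Eᶜ, (n - 2) := by
          -- An unexposed corner fails to be outside some `j ≠ i`, so both `i` and `j` drop out of
          -- the `n` indices.
          refine Finset.sum_le_sum fun a ha => ?_
          obtain ⟨j, hj, hja⟩ : ∃ j, j ≠ i ∧ a ∉ cornersOutside g v i j := by
            simpa [hE, exposedCorners, cornersOutside] using ha
          have : ((Finset.univ.erase i).filter fun j => a ∈ cornersOutside g v i j) ⊆
              (Finset.univ.erase i).erase j := by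
            intro l hl
            rw [Finset.mem_filter] at hl
            refine Finset.mem_erase.2 ⟨?_, hl.1⟩
            rintro rfl
            exact hja hl.2
          refine (Finset.card_le_card this).trans ?_
          rw [Finset.card_erase_of_mem (by simpa using hj), Finset.card_erase_of_mem (by simp)]
          simp
          omega
      _ = (k - E.card) * (n - 2) := by
          rw [Finset.sum_const, Finset.card_compl, Fintype.card_fin, smul_eq_mul]
  calc ∑ j ∈ Finset.univ.erase i, (departures g v i j).ncard
      ≤ ∑ j ∈ Finset.univ.erase i, ((cornersOutside g v i j \ E).card + min E.card 1) :=
        Finset.sum_le_sum fun j hj => ncard_departures_le hn hg (Finset.ne_of_mem_erase hj) hR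
    _ ≤ (k - E.card) * (n - 2) + (n - 1) * min E.card 1 := by
        rw [Finset.sum_add_distrib, Finset.sum_const, Finset.card_erase_of_mem (by simp),
          Finset.card_univ, Fintype.card_fin, smul_eq_mul]
        gcongr
    _ ≤ k * (n - 2) + 1 := by
        have hk : E.card ≤ k := by simpa using Finset.card_le_univ E
        obtain ⟨N, rfl⟩ := Nat.exists_eq_add_of_le' hn
        -- The worst case is one exposed corner: `(k - 1) * (n - 2) + (n - 1) = k * (n - 2) + 1`.
        rcases Nat.eq_zero_or_pos E.card with h | h
        · simp [h]
        · obtain ⟨l, hl⟩ := Nat.exists_eq_add_of_le hk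
          rw [Nat.min_eq_right h, show k - E.card = l by omega,
            show N + 2 - 2 = N by omega, show N + 2 - 1 = N + 1 by omega]
          have : (l + 1) * N ≤ k * N := Nat.mul_le_mul_right N (by omega)
          linarith

/-- The bound on the number of common points, in terms of gauges about a common inner point. -/
theorem ncard_common_le (hn : 2 ≤ n) (hg : ∀ i, IsGauge (g i))
    (hv : ∀ i, IsPolygonal (g i) (v i))
    (hfin : ∀ i j, i ≠ j → {x | g i x = 1 ∧ g j x = 1}.Finite)
    (hR : ∀ i, IsPreconnected {x | g i x < 1 ∧ ∀ j, j ≠ i → 1 < g j x}) :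
    {x | ∃ i j, i ≠ j ∧ g i x = 1 ∧ g j x = 1}.Finite ∧
      {x | ∃ i j, i ≠ j ∧ g i x = 1 ∧ g j x = 1}.ncard ≤ n * (k * (n - 2) + 1) := by
  classical
  have hdfin : ∀ i j, i ≠ j → (departures g v i j).Finite := fun i j hij =>
    (hfin i j hij).subset fun x hx => hx.1
  have hsub : {x | ∃ i j, i ≠ j ∧ g i x = 1 ∧ g j x = 1} ⊆
      ⋃ p ∈ Finset.univ.sigma fun i : Fin n => Finset.univ.erase i, departures g v p.1 p.2 := by
    rintro x ⟨i, j, hij, hi, hj⟩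
    simp only [mem_iUnion]
    rcases exists_corner_of_common (hg i) (hg j) (hv i) (hv j) (hfin i j hij) hi hj with h | h
    · exact ⟨⟨i, j⟩, by simp [hij.symm], ⟨hi, hj⟩, h⟩
    · exact ⟨⟨j, i⟩, by simp [hij], ⟨hj, hi⟩, h⟩
  have hUfin : (⋃ p ∈ Finset.univ.sigma fun i : Fin n => Finset.univ.erase i,
      departures g v p.1 p.2).Finite := by
    refine Set.Finite.biUnion (Finset.finite_toSet _) fun p hp => hdfin _ _ ?_
    have : p.2 ≠ p.1 := by simpa using hp
    exact this.symm
  refine ⟨hUfin.subset hsub, (ncard_le_ncard hsub hUfin).trans ?_⟩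
  refine (Finset.set_ncard_biUnion_le _ _).trans ?_
  rw [Finset.sum_sigma]
  refine (Finset.sum_le_sum fun i _ => sum_ncard_departures_le hn hg i (hR i)).trans ?_
  simp

end Family

/-! ### From boundary curves of convex bodies to gauges. -/

lemma not_isBounded_connectedComponentIn {K : Set Plane} (hK : Convex ℝ K) (hcl : IsClosed K)
    (hne : K.Nonempty) {x : Plane} (hx : x ∉ K) :
    ¬ Bornology.IsBounded (connectedComponentIn (frontier K)ᶜ x) := by
  obtain ⟨q, hq⟩ := hne
  have hxq : x - q ≠ 0 := sub_ne_zero.2 fun e => hx (e ▸ hq)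
  -- The ray from `x` directly away from `q` never enters `K`, since `x` lies between `q` and each
  -- of its points.
  set ray : ℝ → Plane := fun t => x + t • (x - q)
  have hray : ∀ t ∈ Ici (0 : ℝ), ray t ∉ K := by
    intro t ht hmem
    have ht : 0 ≤ t := ht
    apply hx
    have := hK hmem hq (a := 1 / (1 + t)) (b := t / (1 + t)) (by positivity) (by positivity)
      (by field_simp)
    convert this using 1
    have : x = (1 / (1 + t) * (1 + t)) • x := by
      rw [one_div, inv_mul_cancel₀ (by positivity), one_smul]
    simp only [ray]
    conv_lhs => rw [this]
    module
  have hpre : IsPreconnected (ray '' Ici 0) :=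
    isPreconnected_Ici.image _ (by fun_prop)
  have hsub : ray '' Ici 0 ⊆ connectedComponentIn (frontier K)ᶜ x := by
    refine hpre.subset_connectedComponentIn ⟨0, self_mem_Ici, by simp [ray]⟩ ?_
    rintro _ ⟨t, ht, rfl⟩ hf
    exact hray t ht (hcl.frontier_subset hf)
  intro hb
  obtain ⟨R, hR⟩ := (hb.subset hsub).exists_norm_le
  have hpos : 0 < ‖x - q‖ := norm_pos_iff.2 hxq
  have hR' := hR _ ⟨(R + ‖x‖ + 1) / ‖x - q‖, ?_, rfl⟩
  · have h1 : ‖((R + ‖x‖ + 1) / ‖x - q‖) • (x - q)‖ ≤ ‖ray ((R + ‖x‖ + 1) / ‖x - q‖)‖ + ‖x‖ := by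
      have := norm_sub_le (ray ((R + ‖x‖ + 1) / ‖x - q‖)) x
      simpa [ray] using this
    have h2 : R + ‖x‖ + 1 ≤ ‖((R + ‖x‖ + 1) / ‖x - q‖) • (x - q)‖ := by
      rw [norm_smul, Real.norm_eq_abs, abs_div, abs_norm, div_mul_cancel₀ _ hpos.ne']
      exact le_abs_self _
    linarith
  · have h0 := hR (ray 0) ⟨0, self_mem_Ici, rfl⟩
    have : 0 ≤ R := (norm_nonneg _).trans h0
    exact mem_Ici.2 (by positivity)

/-- Off the frontier, the plane splits into the disjoint open sets `interior K` and `(closure K)ᶜ`.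
-/
lemma connectedComponentIn_compl_frontier_subset {K : Set Plane} {x : Plane}
    (hx : x ∈ interior K) : connectedComponentIn (frontier K)ᶜ x ⊆ interior K := by
  have hxF : x ∈ (frontier K)ᶜ := fun h => h.2 hx
  refine isPreconnected_connectedComponentIn.subset_left_of_subset_union isOpen_interior
    (isClosed_closure (s := K)).isOpen_compl ?_ ?_ ⟨x, mem_connectedComponentIn hxF, hx⟩
  · exact disjoint_compl_right.mono_left (interior_subset.trans subset_closure)
  · intro y hy
    have hyF := connectedComponentIn_subset _ _ hy
    by_cases h : y ∈ closure K
    · exact Or.inl (by_contra fun hi => hyF ⟨h, hi⟩)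
    · exact Or.inr h

lemma inside_frontier {K : Set Plane} (hK : Convex ℝ K) (hc : IsCompact K) (hne : K.Nonempty) :
    inside (frontier K) = interior K := by
  ext x
  constructor
  · rintro ⟨hx, hb⟩
    by_cases hxK : x ∈ K
    · exact by_contra fun hi => hx ⟨subset_closure hxK, hi⟩
    · exact absurd hb (not_isBounded_connectedComponentIn hK hc.isClosed hne hxK)
  · intro hx
    exact ⟨fun h => h.2 hx, hc.isBounded.subset
      ((connectedComponentIn_compl_frontier_subset hx).trans interior_subset)⟩

lemma outside_frontier {K : Set Plane} (hK : Convex ℝ K) (hc : IsCompact K) (hne : K.Nonempty) :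
    outside (frontier K) = Kᶜ := by
  ext x
  constructor
  · rintro ⟨hx, hb⟩ hxK
    have hi : x ∈ interior K := by_contra fun hi => hx ⟨subset_closure hxK, hi⟩
    exact hb (hc.isBounded.subset
      ((connectedComponentIn_compl_frontier_subset hi).trans interior_subset))
  · intro hx
    exact ⟨fun h => hx (hc.isClosed.frontier_subset h),
      not_isBounded_connectedComponentIn hK hc.isClosed hne hx⟩

lemma isGauge_gauge {K : Set Plane} (hK : Convex ℝ K) (hb : Bornology.IsBounded K)
    (h0 : K ∈ 𝓝 (0 : Plane)) : IsGauge (gauge K) where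
  continuous := continuous_gauge hK h0
  pos x hx := (gauge_pos (absorbent_nhds_zero h0)
    ((NormedSpace.isVonNBounded_iff ℝ).2 hb)).2 hx
  smul c x hc := by simpa using gauge_smul_of_nonneg (s := K) hc x
  add_le := gauge_add_le hK (absorbent_nhds_zero h0)

/-- The bound for boundary curves of compact convex sets with a common inner point. -/
theorem ncard_vertexSet_le {n k : ℕ} (hn : 2 ≤ n) {K : Fin n → Set Plane}
    {v : Fin n → Fin k → Plane} {p : Plane} (hK : ∀ i, Convex ℝ (K i))
    (hc : ∀ i, IsCompact (K i)) (hp : ∀ i, p ∈ interior (K i))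
    (hv : ∀ i, ∀ x ∈ frontier (K i), ∃ a b, x ∈ segment ℝ (v i a) (v i b) ∧
      segment ℝ (v i a) (v i b) ⊆ frontier (K i))
    (hfin : ∀ i j, i ≠ j → (frontier (K i) ∩ frontier (K j)).Finite)
    (hR : ∀ i, IsPreconnected {x | x ∈ interior (K i) ∧ ∀ j, j ≠ i → x ∉ K j}) :
    (vertexSet fun i => frontier (K i)).Finite ∧
      (vertexSet fun i => frontier (K i)).ncard ≤ n * (k * (n - 2) + 1) := by
  -- Gauges are centred at the origin, so `p` is moved there.
  set τ : Plane ≃ₜ Plane := Homeomorph.addLeft p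
  have hτ : ∀ x, τ x = p + x := fun _ => rfl
  have hτs : ∀ x, τ.symm x = x - p := fun x => by
    rw [Homeomorph.symm_apply_eq, hτ]; abel
  set g : Fin n → Plane → ℝ := fun i => gauge (τ ⁻¹' K i)
  have hconv : ∀ i, Convex ℝ (τ ⁻¹' K i) := fun i => (hK i).translate_preimage_right p
  have hnhds : ∀ i, τ ⁻¹' K i ∈ 𝓝 (0 : Plane) := fun i => by
    apply τ.continuous.continuousAt.preimage_mem_nhds
    simpa [hτ] using mem_interior_iff_mem_nhds.1 (hp i)
  have hcomp : ∀ i, IsCompact (τ ⁻¹' K i) := fun i => τ.isCompact_preimage.2 (hc i)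
  have hg : ∀ i, IsGauge (g i) := fun i =>
    isGauge_gauge (hconv i) (hcomp i).isBounded (hnhds i)
  have hlt : ∀ i x, g i x < 1 ↔ τ x ∈ interior (K i) := fun i x => by
    rw [gauge_lt_one_iff_mem_interior (hconv i) (hnhds i), ← τ.preimage_interior]; rfl
  have hgt : ∀ i x, 1 < g i x ↔ τ x ∉ K i := fun i x => by
    rw [← not_le, gauge_le_one_iff_mem_closure (hconv i) (hnhds i),
      (hcomp i).isClosed.closure_eq]; rfl
  have heq : ∀ i x, g i x = 1 ↔ τ x ∈ frontier (K i) := fun i x => by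
    rw [gauge_eq_one_iff_mem_frontier (hconv i) (hnhds i), ← τ.preimage_frontier]; rfl
  have hseg : ∀ x y z, x ∈ segment ℝ (y - p) (z - p) ↔ τ x ∈ segment ℝ y z := fun x y z => by
    rw [hτ, ← mem_segment_translate ℝ p (b := y - p)]
    simp
  have key := ncard_common_le (v := fun i a => v i a - p) hn hg ?_ ?_ ?_
  · have himg : (vertexSet fun i => frontier (K i)) =
        τ '' {x | ∃ i j, i ≠ j ∧ g i x = 1 ∧ g j x = 1} := by
      ext x
      rw [← τ.toEquiv.apply_symm_apply x]
      simp only [vertexSet, heq, mem_ofPred_eq, Homeomorph.coe_toEquiv]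
      rw [τ.injective.mem_set_image]
      rfl
    rw [himg]
    exact ⟨key.1.image _, by rw [ncard_image_of_injective _ τ.injective]; exact key.2⟩
  · intro i x hx
    obtain ⟨a, b, h1, h2⟩ := hv i _ ((heq i x).1 hx)
    exact ⟨a, b, (hseg _ _ _).2 h1, fun y hy => (heq i y).2 (h2 ((hseg _ _ _).1 hy))⟩
  · intro i j hij
    refine ((hfin i j hij).preimage τ.injective.injOn).subset ?_
    rintro x ⟨h1, h2⟩
    exact ⟨(heq i x).1 h1, (heq j x).1 h2⟩
  · intro i
    convert (hR i).image τ.symm τ.symm.continuous.continuousOn using 1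
    rw [τ.symm.image_eq_preimage_symm]
    ext x
    simp [hlt, hgt]

end VennKGon

theorem theorem1 (n k : ℕ) (hn : 2 ≤ n) (C : Fin n → Set VennKGon.Plane)
    (hVenn : VennKGon.IsVennDiagram C) (hgon : ∀ i, VennKGon.IsConvexKGon k (C i)) :
    (VennKGon.vertexSet C).Finite ∧
      ((VennKGon.vertexSet C).ncard : ℤ) ≤ 2 * (k : ℤ) * (n.choose 2 : ℤ) - (n : ℤ) * ((k : ℤ) - 1) := by
  have hk : 3 ≤ k := (hgon ⟨0, by omega⟩).1
  have : Nonempty (Fin k) := ⟨⟨0, by omega⟩⟩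
  choose P _ hP hCP using fun i => (hgon i).2
  set K : Fin n → Set VennKGon.Plane := fun i => convexHull ℝ (Set.range (P i).vertices)
  have hCK : C = fun i => frontier (K i) := funext fun i => (hCP i).trans (hP i)
  have hconv : ∀ i, Convex ℝ (K i) := fun i => convex_convexHull ℝ _
  have hcomp : ∀ i, IsCompact (K i) := fun i => (Set.finite_range _).isCompact_convexHull ℝ
  have hne : ∀ i, (K i).Nonempty := fun i => (Set.range_nonempty _).convexHull
  have hin : ∀ i, VennKGon.inside (C i) = interior (K i) := fun i => by
    rw [hCK]; exact VennKGon.inside_frontier (hconv i) (hcomp i) (hne i)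
  have hout : ∀ i, VennKGon.outside (C i) = (K i)ᶜ := fun i => by
    rw [hCK]; exact VennKGon.outside_frontier (hconv i) (hcomp i) (hne i)
  -- The region inside all curves supplies the common centre; the singleton regions below supply the
  -- connectedness.
  obtain ⟨p, hp⟩ := (hVenn.connected_region Set.univ).nonempty
  have hmain := VennKGon.ncard_vertexSet_le (v := fun i => (P i).vertices) (p := p) hn hconv hcomp
    (fun i => hin i ▸ (hp i).1 (Set.mem_univ i)) ?_ ?_ ?_
  · rw [← hCK] at hmain
    refine ⟨hmain.1, (Int.ofNat_le.2 hmain.2).trans (le_of_eq ?_)⟩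
    obtain ⟨N, rfl⟩ := Nat.exists_eq_add_of_le' hn
    -- With `2 * n.choose 2 = n * (n - 1)`, the bound `n * (k * (n - 2) + 1)` becomes the stated
    -- one.
    have h2 : (2 : ℤ) * ((N + 2).choose 2 : ℤ) = (N + 2) * (N + 1) := by
      have h := Nat.choose_two_right (N + 2)
      have hd : 2 ∣ (N + 2) * (N + 2 - 1) := (Nat.even_mul_pred_self (N + 2)).two_dvd
      have h' : 2 * (N + 2).choose 2 = (N + 2) * (N + 1) := by
        rw [h, Nat.mul_div_cancel' hd]; rfl
      exact_mod_cast h'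
    simp only [Nat.add_sub_cancel]
    push_cast
    linear_combination -(k : ℤ) * h2
  · intro i x hx
    have hx' : x ∈ (P i).boundary ℝ := hP i ▸ hx
    obtain ⟨a, ha⟩ := Set.mem_iUnion.1 hx'
    refine ⟨a, finRotate k a, ?_, ?_⟩
    · rw [← affineSegment_eq_segment]; exact ha
    · rw [← affineSegment_eq_segment]
      exact (Set.subset_iUnion (fun a => (P i).edgeSet ℝ a) a).trans (hP i).subset
  · intro i j hij
    have := hVenn.finite_inter i j hij
    rwa [hCK] at this
  · intro i
    convert (hVenn.connected_region {i}).isPreconnected using 1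
    ext x
    simp only [VennKGon.region, hin, hout, Set.mem_singleton_iff, Set.mem_ofPred_eq,
      Set.mem_compl_iff]
    constructor
    · rintro ⟨h1, h2⟩ j
      exact ⟨fun e => e ▸ h1, h2 j⟩
    · exact fun h => ⟨(h i).1 rfl, fun j => (h j).2⟩
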